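/- Let $\tau\in\mathbb R$ be fixed. Let $\Sigma=\Sigma_-\cup\Sigma_+$, where for some $\delta>0$ the contour $\Sigma_+$ consists of the ray from $\delta+\infty e^{i\pi/4}$ to $\delta$ followed by the ray from $\delta$ to $\delta+\infty e^{-i\pi/4}$, and $\Sigma_-$ consists of the ray from $-\delta+\infty e^{-3i\pi/4}$ to $-\delta$ followed by the ray from $-\delta$ to $-\delta+\infty e^{3i\pi/4}$. With $i\mathbb R$ oriented upwards, put for $s\in\mathbb R$ $$Q(s)=\frac1{2i\pi}\int_{i\mathbb R}e^{-\frac{\mu^4}4+\tau\frac{\mu^2}2+s\mu}\,d\mu,\qquad P(s)=\frac1{2i\pi}\int_{\Sigma}e^{\frac{\mu^4}4-\tau\frac{\mu^2}2-s\mu}\,d\mu .$$ Let $\varphi(s)=\frac34\sin\left(\frac{2\pi}3\right)s^{4/3}-\frac\tau2\sin\left(\frac{2\pi}3\right)s^{2/3}$. Then, as $s\to+\infty$, $$Q(s)=\sqrt{\frac2{3\pi}}\,s^{-1/3}e^{-\frac38s^{4/3}-\frac\tau4s^{2/3}+\frac{\tau^2}6}\left(\cos\left(\varphi(s)-\frac\pi6\right)+o(1)\right),$$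 $$P(s)=\sqrt{\frac2{3\pi}}\,s^{-1/3}e^{\frac38s^{4/3}+\frac\tau4s^{2/3}-\frac{\tau^2}6}\left(\cos\left(\varphi(s)-\frac\pi3\right)+o(1)\right).$$ -/

import Mathlib

open Filter Asymptotics MeasureTheory

noncomputable section

/-- The integral of `f` along the ray from `z` to infinity in direction `w`,
parametrised by `r ↦ z + r w`, `r > 0`. -/
def rayIntegral (f : ℂ → ℂ) (z w : ℂ) : ℂ :=
  ∫ r in Set.Ioi (0 : ℝ), f (z + (r : ℂ) * w) * w

/-- The integral of `f` along the imaginary axis, oriented upwards. -/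
def imagAxisIntegral (f : ℂ → ℂ) : ℂ :=
  ∫ t : ℝ, f ((t : ℂ) * Complex.I) * Complex.I

/-- The direction `e ^ (i α)`. -/
def direction (α : ℝ) : ℂ := Complex.exp ((α : ℂ) * Complex.I)

/-- The integral of `f` along the Pearcey contour `Σ = Σ₋ ∪ Σ₊`, whose two components
lie on the two sides of the imaginary axis:
`Σ₊` comes from infinity in direction `e ^ (i π / 4)` to the point `δ`, and leaves it to infinity
in direction `e ^ (-i π / 4)`;
`Σ₋` comes from infinity in direction `e ^ (-3 i π / 4)` to the point `-δ`, and leaves it to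
infinity in direction `e ^ (3 i π / 4)`. -/
def sigmaIntegral (δ : ℝ) (f : ℂ → ℂ) : ℂ :=
  (-rayIntegral f δ (direction (Real.pi / 4)) + rayIntegral f δ (direction (-(Real.pi / 4))))
  + (-rayIntegral f (-δ) (direction (-(3 * Real.pi / 4)))
      + rayIntegral f (-δ) (direction (3 * Real.pi / 4)))

/-- The phase `θ_s(μ) = μ⁴ / 4 - τ μ² / 2 - s μ`. -/
def pearceyPhase (τ s : ℝ) (μ : ℂ) : ℂ :=
  μ ^ 4 / 4 - (τ : ℂ) * μ ^ 2 / 2 - (s : ℂ) * μ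

/-- `Q(s) = (1 / (2 i π)) ∫_{iℝ} exp (-μ⁴ / 4 + τ μ² / 2 + s μ) dμ`. -/
def pearceyQ (τ s : ℝ) : ℂ :=
  1 / (2 * Complex.I * (Real.pi : ℂ)) *
    imagAxisIntegral (fun μ => Complex.exp (-pearceyPhase τ s μ))

/-- `P(s) = (1 / (2 i π)) ∫_Σ exp (μ⁴ / 4 - τ μ² / 2 - s μ) dμ`, where `δ` fixes
the position of the contour `Σ`. -/
def pearceyP (δ τ s : ℝ) : ℂ :=
  1 / (2 * Complex.I * (Real.pi : ℂ)) *
    sigmaIntegral δ (fun μ => Complex.exp (pearceyPhase τ s μ))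

/-- The amplitude `√(2 / (3 π)) s ^ (-1/3)`. -/
def pearceyAmplitude (s : ℝ) : ℝ :=
  Real.sqrt (2 / (3 * Real.pi)) * s ^ (-(1 / 3) : ℝ)

/-- The exponent `(3 / 8) s ^ (4/3) + (τ / 4) s ^ (2/3) - τ² / 6`. -/
def pearceyExponent (τ s : ℝ) : ℝ :=
  3 / 8 * s ^ (4 / 3 : ℝ) + τ / 4 * s ^ (2 / 3 : ℝ) - τ ^ 2 / 6

/-- The oscillation `(3 / 4) sin (2 π / 3) s ^ (4/3) - (τ / 2) sin (2 π / 3) s ^ (2/3)`. -/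
def pearceyOscillation (τ s : ℝ) : ℝ :=
  3 / 4 * Real.sin (2 * Real.pi / 3) * s ^ (4 / 3 : ℝ)
    - τ / 2 * Real.sin (2 * Real.pi / 3) * s ^ (2 / 3 : ℝ)

end

/-! This is the saddle-point method. With s = σ³ and μ = σz the exponent of Q becomes σ⁴(z − z⁴/4) +
σ²τz²/2, and that of P is its negative, so for large σ the saddles are the cube roots of unity. The
asymptotics come from ω = e^{2πi/3} and its conjugate.

Both contours are symmetric under conjugation, so 1/(2πi) times the integral is 1/π times an
imaginary part of integrals along rays in the upper half-plane with real base point. By Cauchy's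
theorem (`rayIntegral_sub_rayIntegral`), moving the base point along ℝ and turning the ray inside a
sector of decay changes such an integral by an integral over a real segment, which is real; hence
the imaginary part does not change (`im_rayIntegral_eq`). The rays can therefore be made to pass
through σω: vertically from −σ/2 for Q, and from σ in direction e^{5πi/6} for the left component of
P. The right component of P becomes a ray from the real saddle σ; it has size about e^{−3σ⁴/4} and
is negligible against e^{3σ⁴/8} (`tendsto_rayIntegral_real_saddle`).

On a ray through the saddle the real part of the leading exponent drops at least quadratically, so
Laplace's method (`tendsto_laplace`, `tendsto_rayIntegral_saddle`) leaves a Gaussian integral. The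
τ-term survives there as a linear term of order one, and completing the square gives e^{±τ²/6}. The
argument of the Gaussian integral times the direction of the ray produces the shifts π/6 and π/3. -/

/-! ### Exponentials of quartics and Cauchy's theorem for rays -/

/-- The exponential of the quartic `A μ⁴ + B μ² + C μ`. -/
noncomputable def expQuartic (A B C : ℝ) (μ : ℂ) : ℂ :=
  Complex.exp ((A : ℂ) * μ ^ 4 + (B : ℂ) * μ ^ 2 + (C : ℂ) * μ)

theorem differentiable_expQuartic (A B C : ℝ) : Differentiable ℂ (expQuartic A B C) := by
  unfold expQuartic; fun_prop

theorem continuous_expQuartic (A B C : ℝ) : Continuous (expQuartic A B C) :=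
  (differentiable_expQuartic A B C).continuous

theorem expQuartic_conj (A B C : ℝ) (μ : ℂ) :
    expQuartic A B C (starRingEnd ℂ μ) = starRingEnd ℂ (expQuartic A B C μ) := by
  simp [expQuartic, ← Complex.exp_conj]

/-- Uniform decay of the exponential of a quartic along a compact family of rays. -/
theorem eventually_norm_expQuartic_le {A B C : ℝ} {p q : ℝ → ℂ} (hp : Continuous p)
    (hq : Continuous q) (h : ∀ t ∈ Set.Icc (0 : ℝ) 1, ((A : ℂ) * q t ^ 4).re < 0) :
    ∀ᶠ R : ℝ in atTop, ∀ t ∈ Set.Icc (0 : ℝ) 1,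
      ‖expQuartic A B C (p t + (R : ℂ) * q t)‖ ≤ Real.exp (-R) := by
  have hne : (Set.Icc (0 : ℝ) 1).Nonempty := ⟨0, by simp⟩
  obtain ⟨t₀, ht₀, hmax⟩ := isCompact_Icc.exists_isMaxOn hne
    (f := fun t => ((A : ℂ) * q t ^ 4).re) (by fun_prop)
  set m := ((A : ℂ) * q t₀ ^ 4).re with hm
  have hm0 : m < 0 := h t₀ ht₀
  set c₃ : ℝ → ℝ := fun t => ((A : ℂ) * (4 * p t * q t ^ 3)).re
  set c₂ : ℝ → ℝ := fun t => ((A : ℂ) * (6 * p t ^ 2 * q t ^ 2) + B * q t ^ 2).re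
  set c₁ : ℝ → ℝ := fun t => ((A : ℂ) * (4 * p t ^ 3 * q t) + B * (2 * p t * q t) + C * q t).re
  set c₀ : ℝ → ℝ := fun t => ((A : ℂ) * p t ^ 4 + B * p t ^ 2 + C * p t).re
  obtain ⟨t₁, -, hK⟩ := isCompact_Icc.exists_isMaxOn hne
    (f := fun t => |c₃ t| + |c₂ t| + |c₁ t| + |c₀ t|) (by fun_prop)
  set K := |c₃ t₁| + |c₂ t₁| + |c₁ t₁| + |c₀ t₁| with hKd
  have hK0 : 0 ≤ K := by positivity
  -- Beyond this threshold the leading term wins: R⁴m + R³K ≤ −R³ ≤ −R.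
  filter_upwards [eventually_ge_atTop (max 1 ((K + 1) / (-m)))] with R hR t ht
  have hR1 : 1 ≤ R := le_trans (le_max_left _ _) hR
  have hR2 : K + 1 ≤ R * (-m) := by
    rw [← div_le_iff₀ (by linarith)]; exact le_trans (le_max_right _ _) hR
  rw [expQuartic, Complex.norm_exp]
  refine Real.exp_le_exp.2 ?_
  have e : ((A : ℂ) * (p t + (R : ℂ) * q t) ^ 4 + (B : ℂ) * (p t + (R : ℂ) * q t) ^ 2
      + (C : ℂ) * (p t + (R : ℂ) * q t)).re
      = R ^ 4 * ((A : ℂ) * q t ^ 4).re + R ^ 3 * c₃ t + R ^ 2 * c₂ t + R * c₁ t + c₀ t := by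
    simp only [c₃, c₂, c₁, c₀, ← Complex.re_ofReal_mul, ← Complex.add_re]
    congr 1
    push_cast
    ring
  have h1 : ((A : ℂ) * q t ^ 4).re ≤ m := hmax ht
  have h2 : |c₃ t| + |c₂ t| + |c₁ t| + |c₀ t| ≤ K := hK ht
  rw [e]
  have b3 : R ^ 3 * c₃ t ≤ R ^ 3 * |c₃ t| := by gcongr; exact le_abs_self _
  have b2 : R ^ 2 * c₂ t ≤ R ^ 3 * |c₂ t| := by
    refine le_trans (mul_le_mul_of_nonneg_left (le_abs_self _) (by positivity)) ?_
    gcongr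
    norm_num
  have b1 : R * c₁ t ≤ R ^ 3 * |c₁ t| := by
    refine le_trans (mul_le_mul_of_nonneg_left (le_abs_self _) (by positivity)) ?_
    gcongr; exact le_self_pow₀ hR1 (by norm_num)
  have b0 : c₀ t ≤ R ^ 3 * |c₀ t| := by
    refine (le_abs_self _).trans (le_mul_of_one_le_left (abs_nonneg _) (one_le_pow₀ hR1))
  have b4 : R ^ 4 * ((A : ℂ) * q t ^ 4).re ≤ R ^ 4 * m := by gcongr
  have b5 : R ^ 3 * (|c₃ t| + |c₂ t| + |c₁ t| + |c₀ t|) ≤ R ^ 3 * K := by gcongr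
  have b6 : R ^ 3 * (K + 1) ≤ R ^ 3 * (R * (-m)) := by gcongr
  have b7 : R ≤ R ^ 3 := le_self_pow₀ hR1 (by norm_num)
  nlinarith

theorem integrableOn_expQuartic_ray {A B C : ℝ} {z w : ℂ} (h : ((A : ℂ) * w ^ 4).re < 0) :
    IntegrableOn (fun r : ℝ => expQuartic A B C (z + (r : ℂ) * w) * w) (Set.Ioi 0) := by
  have hc := continuous_expQuartic A B C
  have hcont : Continuous (fun r : ℝ => expQuartic A B C (z + (r : ℂ) * w) * w) := by fun_prop
  have hb := eventually_norm_expQuartic_le (A := A) (B := B) (C := C) (p := fun _ => z)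
    (q := fun _ => w) (by fun_prop) (by fun_prop) (fun _ _ => h)
  refine (integrable_norm_iff hcont.aestronglyMeasurable).1 ?_
  refine integrable_of_isBigO_exp_neg (b := 1) one_pos hcont.norm.continuousOn ?_
  refine IsBigO.of_bound ‖w‖ ?_
  filter_upwards [hb] with R hR
  have := hR 0 (by simp)
  rw [norm_norm, norm_mul, mul_comm, neg_one_mul, Real.norm_eq_abs, Real.abs_exp]
  gcongr

/-- Cauchy's theorem for rays: moving a ray inside a sector of decay changes the integral by a
difference of values of a primitive. -/
theorem rayIntegral_sub_rayIntegral {A B C : ℝ} {F : ℂ → ℂ}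
    (hF : ∀ μ, HasDerivAt F (expQuartic A B C μ) μ) {z z' w w' : ℂ}
    (h : ∀ t ∈ Set.Icc (0 : ℝ) 1, ((A : ℂ) * (w + (t : ℂ) * (w' - w)) ^ 4).re < 0) :
    rayIntegral (expQuartic A B C) z w - rayIntegral (expQuartic A B C) z' w' = F z' - F z := by
  have key : ∀ z w : ℂ, ((A : ℂ) * w ^ 4).re < 0 →
      Tendsto (fun R : ℝ => F (z + (R : ℂ) * w) - F z) atTop
        (nhds (rayIntegral (expQuartic A B C) z w)) := by
    intro z w hw
    have hd : ∀ r : ℝ, HasDerivAt (fun r : ℝ => F (z + (r : ℂ) * w))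
        (expQuartic A B C (z + (r : ℂ) * w) * w) r := by
      intro r
      have h1 : HasDerivAt (fun r : ℝ => z + (r : ℂ) * w) w r := by
        simpa using ((Complex.ofRealCLM.hasDerivAt (x := r)).mul_const w).const_add z
      exact (hF _).comp r h1
    have hc := continuous_expQuartic A B C
    have := intervalIntegral_tendsto_integral_Ioi 0
      (integrableOn_expQuartic_ray (B := B) (C := C) (z := z) hw) tendsto_id
    refine this.congr fun R => ?_
    have hcont : Continuous (fun r : ℝ => expQuartic A B C (z + (r : ℂ) * w) * w) := by fun_prop
    rw [intervalIntegral.integral_eq_sub_of_hasDerivAt (fun r _ => hd r)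
      (hcont.intervalIntegrable _ _)]
    simp
  have k1 := key z w (by simpa using h 0 (by simp))
  have k2 := key z' w' (by simpa using h 1 (by simp))
  have hb := eventually_norm_expQuartic_le (A := A) (B := B) (C := C)
    (p := fun t => z + (t : ℂ) * (z' - z)) (q := fun t => w + (t : ℂ) * (w' - w))
    (by fun_prop) (by fun_prop) h
  -- The far endpoints of the truncated rays are joined by a segment of length O(R), on which the
  -- integrand is at most e^{−R}.
  have k3 : Tendsto (fun R : ℝ => F (z + (R : ℂ) * w) - F (z' + (R : ℂ) * w')) atTop (nhds 0) := by
    have hlim : Tendsto (fun R : ℝ => Real.exp (-R) * ‖z - z'‖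
        + R ^ 1 * Real.exp (-R) * ‖w - w'‖) atTop (nhds 0) := by
      simpa using (Real.tendsto_exp_neg_atTop_nhds_zero.mul_const ‖z - z'‖).add
        ((Real.tendsto_pow_mul_exp_neg_atTop_nhds_zero 1).mul_const ‖w - w'‖)
    refine squeeze_zero_norm' ?_ hlim
    filter_upwards [hb, eventually_ge_atTop 0] with R hR hR0
    have := Convex.norm_image_sub_le_of_norm_hasDerivWithin_le (f := F) (C := Real.exp (-R))
      (s := segment ℝ (z' + (R : ℂ) * w') (z + (R : ℂ) * w))
      (fun x _ => (hF x).hasDerivWithinAt) ?_ (convex_segment _ _)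
      (left_mem_segment _ _ _) (right_mem_segment _ _ _)
    · refine this.trans ?_
      have e : z + (R : ℂ) * w - (z' + (R : ℂ) * w') = (z - z') + (R : ℂ) * (w - w') := by ring
      have : ‖(z - z') + (R : ℂ) * (w - w')‖ ≤ ‖z - z'‖ + R * ‖w - w'‖ := by
        refine (norm_add_le _ _).trans ?_
        simp [abs_of_nonneg hR0]
      rw [e]
      calc _ ≤ Real.exp (-R) * (‖z - z'‖ + R * ‖w - w'‖) := by gcongr
        _ = _ := by ring
    · intro x hx
      rw [segment_symm, segment_eq_image'] at hx
      obtain ⟨t, ht, rfl⟩ := hx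
      have e : z + (R : ℂ) * w + t • (z' + (R : ℂ) * w' - (z + (R : ℂ) * w))
          = z + (t : ℂ) * (z' - z) + (R : ℂ) * (w + (t : ℂ) * (w' - w)) := by
        rw [Complex.real_smul]; ring
      simpa only [e] using hR t ht
  have k4 := tendsto_nhds_unique ((k1.sub k2).congr fun R => ?_) (k3.add_const (F z' - F z))
  · simpa using k4
  · ring

theorem exists_primitive {f : ℂ → ℂ} (hf : Differentiable ℂ f) :
    ∃ F : ℂ → ℂ, ∀ z, HasDerivAt F (f z) z := by
  obtain ⟨F, hF⟩ := hf.isExactOn_univ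
  exact ⟨F, fun z => hF z (Set.mem_univ z)⟩

theorem rayIntegral_conj (A B C : ℝ) (z w : ℂ) :
    rayIntegral (expQuartic A B C) (starRingEnd ℂ z) (starRingEnd ℂ w)
      = starRingEnd ℂ (rayIntegral (expQuartic A B C) z w) := by
  rw [rayIntegral, rayIntegral, ← integral_conj]
  congr 1
  ext r
  rw [map_mul, ← expQuartic_conj]
  simp

/-- For a real base point, the imaginary part of the integral along a ray depends only on the
sector of decay. -/
theorem im_rayIntegral_eq {A B C x x' : ℝ} {w w' : ℂ}
    (h : ∀ t ∈ Set.Icc (0 : ℝ) 1, ((A : ℂ) * (w + (t : ℂ) * (w' - w)) ^ 4).re < 0) :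
    (rayIntegral (expQuartic A B C) x w).im = (rayIntegral (expQuartic A B C) x' w').im := by
  obtain ⟨F, hF⟩ := exists_primitive (differentiable_expQuartic A B C)
  have h1 := rayIntegral_sub_rayIntegral hF (z := x) (z' := x') h
  -- The same identity for the conjugate rays has the same right-hand side, because x and x' are
  -- real. So the difference of the integrals equals its own conjugate.
  have h2 := rayIntegral_sub_rayIntegral hF (z := x) (z' := x')
    (w := starRingEnd ℂ w) (w' := starRingEnd ℂ w') (fun t ht => by
      have := h t ht
      rw [← Complex.conj_re] at this
      simpa using this)
  have h3 := rayIntegral_conj A B C x w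
  have h4 := rayIntegral_conj A B C x' w'
  rw [Complex.conj_ofReal] at h3 h4
  rw [h3, h4, ← h1] at h2
  have := congrArg Complex.im h2
  simp at this
  linarith

/-! ### Laplace's method at a saddle point -/

/-- Laplace's method for a quartic exponent perturbed by a quadratic one. -/
theorem tendsto_laplace {g₂ g₃ g₄ k₁ k₂ : ℂ} {a c : ℝ} (ha : 0 < a) (hc : 0 < c)
    (H : ∀ ρ : ℝ, -a < ρ →
      (g₂ * (ρ : ℂ) ^ 2 + g₃ * (ρ : ℂ) ^ 3 + g₄ * (ρ : ℂ) ^ 4).re ≤ -c * ρ ^ 2) :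
    Tendsto (fun b : ℝ => (b : ℂ) * ∫ ρ in Set.Ioi (-a), Complex.exp ((b : ℂ) ^ 2 *
      (g₂ * (ρ : ℂ) ^ 2 + g₃ * (ρ : ℂ) ^ 3 + g₄ * (ρ : ℂ) ^ 4)
        + (b : ℂ) * (k₁ * (ρ : ℂ) + k₂ * (ρ : ℂ) ^ 2))) atTop
      (nhds (∫ x : ℝ, Complex.exp (g₂ * (x : ℂ) ^ 2 + k₁ * (x : ℂ)))) := by
  -- The integrand after x = bρ: the cubic term and k₂ carry a factor 1/b, the quartic term 1/b²,
  -- and only g₂ and k₁ survive in the limit.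
  set G : ℝ → ℝ → ℂ := fun b x => Complex.exp (g₂ * (x : ℂ) ^ 2 + k₁ * (x : ℂ)
    + ((b⁻¹ : ℝ) : ℂ) * (g₃ * (x : ℂ) ^ 3 + k₂ * (x : ℂ) ^ 2)
    + ((b⁻¹ : ℝ) : ℂ) ^ 2 * (g₄ * (x : ℂ) ^ 4)) with hG
  have hGb : ∀ b : ℝ, 0 < b → ∀ ρ : ℝ, G b (b * ρ) = Complex.exp ((b : ℂ) ^ 2 *
      (g₂ * (ρ : ℂ) ^ 2 + g₃ * (ρ : ℂ) ^ 3 + g₄ * (ρ : ℂ) ^ 4)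
        + (b : ℂ) * (k₁ * (ρ : ℂ) + k₂ * (ρ : ℂ) ^ 2)) := by
    intro b hb ρ
    have : (b : ℂ) ≠ 0 := by exact_mod_cast hb.ne'
    simp only [hG]
    congr 1
    push_cast
    field_simp
    ring
  have key : Tendsto (fun b : ℝ => ∫ x : ℝ, (Set.Ioi (b * -a)).indicator (G b) x) atTop
      (nhds (∫ x : ℝ, Complex.exp (g₂ * (x : ℂ) ^ 2 + k₁ * (x : ℂ)))) := by
    -- Of the decay −cx² given by `H`, the k₂ term uses up at most cx²/2 once b ≥ 2‖k₂‖/c. The k₁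
    -- term uses up cx²/4, by Young's inequality with remainder ‖k₁‖²/c.
    refine tendsto_integral_filter_of_dominated_convergence
      (fun x => Real.exp (-(c / 4) * x ^ 2) * Real.exp (‖k₁‖ ^ 2 / c)) ?_ ?_ ?_ ?_
    · refine Eventually.of_forall fun b => ?_
      have : Continuous (G b) := by fun_prop
      exact this.aestronglyMeasurable.indicator measurableSet_Ioi
    · filter_upwards [eventually_gt_atTop 0, eventually_ge_atTop (2 * ‖k₂‖ / c)] with b hb hb2
      refine Eventually.of_forall fun x => ?_
      by_cases hx : x ∈ Set.Ioi (b * -a)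
      · rw [Set.indicator_of_mem hx]
        obtain ⟨ρ, rfl⟩ : ∃ ρ, x = b * ρ := ⟨x / b, by field_simp⟩
        have hρ : -a < ρ := lt_of_mul_lt_mul_left hx hb.le
        rw [hGb b hb, Complex.norm_exp, ← Real.exp_add]
        refine Real.exp_le_exp.2 ?_
        have h1 := H ρ hρ
        have e : ((b : ℂ) ^ 2 *
            (g₂ * (ρ : ℂ) ^ 2 + g₃ * (ρ : ℂ) ^ 3 + g₄ * (ρ : ℂ) ^ 4)
            + (b : ℂ) * (k₁ * (ρ : ℂ) + k₂ * (ρ : ℂ) ^ 2)).re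
            = b ^ 2 * (g₂ * (ρ : ℂ) ^ 2 + g₃ * (ρ : ℂ) ^ 3 + g₄ * (ρ : ℂ) ^ 4).re
              + b * (k₁.re * ρ + k₂.re * ρ ^ 2) := by
          rw [Complex.add_re, ← Complex.ofReal_pow, Complex.re_ofReal_mul, Complex.re_ofReal_mul,
            Complex.add_re (k₁ * _), Complex.re_mul_ofReal, ← Complex.ofReal_pow, Complex.re_mul_ofReal]
        rw [e]
        have h2 : k₁.re * (b * ρ) ≤ ‖k₁‖ * |b * ρ| :=
          (le_abs_self _).trans (by rw [abs_mul]; gcongr; exact Complex.abs_re_le_norm _)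
        have h3 : k₂.re ≤ ‖k₂‖ := (le_abs_self _).trans (Complex.abs_re_le_norm _)
        have h4 : ‖k₂‖ ≤ c / 2 * b := by
          rw [div_le_iff₀ hc] at hb2; linarith
        have h5 : b * (k₂.re * ρ ^ 2) ≤ b * (c / 2 * b * ρ ^ 2) := by
          gcongr; exact h3.trans h4
        have h6 : b ^ 2 * (g₂ * (ρ : ℂ) ^ 2 + g₃ * (ρ : ℂ) ^ 3 + g₄ * (ρ : ℂ) ^ 4).re
            ≤ b ^ 2 * (-c * ρ ^ 2) := by gcongr
        have h7 : ‖k₁‖ * |b * ρ| ≤ c / 4 * (b * ρ) ^ 2 + ‖k₁‖ ^ 2 / c := by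
          rw [← sq_abs (b * ρ)]
          have : c / 4 * |b * ρ| ^ 2 + ‖k₁‖ ^ 2 / c - ‖k₁‖ * |b * ρ|
              = c * (|b * ρ| / 2 - ‖k₁‖ / c) ^ 2 := by field_simp; ring
          have h8 : 0 ≤ c * (|b * ρ| / 2 - ‖k₁‖ / c) ^ 2 := by positivity
          linarith
        linarith
      · rw [Set.indicator_of_notMem hx, norm_zero]
        positivity
    · exact (integrable_exp_neg_mul_sq (by positivity)).mul_const _
    · refine Eventually.of_forall fun x => ?_
      have hlim : Tendsto (fun b : ℝ => G b x) atTop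
          (nhds (Complex.exp (g₂ * (x : ℂ) ^ 2 + k₁ * (x : ℂ)))) := by
        have h0 : Continuous (fun y : ℝ => Complex.exp (g₂ * (x : ℂ) ^ 2 + k₁ * (x : ℂ)
          + (y : ℂ) * (g₃ * (x : ℂ) ^ 3 + k₂ * (x : ℂ) ^ 2)
          + (y : ℂ) ^ 2 * (g₄ * (x : ℂ) ^ 4))) := by fun_prop
        have h1 := (h0.tendsto 0).comp (tendsto_inv_atTop_zero (𝕜 := ℝ))
        simpa [hG, Function.comp_def] using h1
      refine hlim.congr' ?_
      filter_upwards [eventually_gt_atTop (-x / a)] with b hb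
      rw [Set.indicator_of_mem]
      rw [div_lt_iff₀ ha] at hb
      simp only [Set.mem_Ioi]
      linarith
  refine key.congr' ?_
  filter_upwards [eventually_gt_atTop 0] with b hb
  rw [integral_indicator measurableSet_Ioi, ← integral_comp_mul_left_Ioi' _ _ hb,
    Complex.real_smul]
  simp only [hGb b hb]

/-- The leading behaviour of the integral along a ray that passes through a simple saddle point
`ω = x₀ + a w` of `A z⁴ + C z`. -/
theorem tendsto_rayIntegral_saddle {A B C x₀ a c : ℝ} {w ω : ℂ} (ha : 0 < a) (hc : 0 < c)
    (hω : (x₀ : ℂ) + a * w = ω) (hs : 4 * (A : ℂ) * ω ^ 3 + C = 0)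
    (H : ∀ ρ : ℝ, -a < ρ → (6 * A * ω ^ 2 * w ^ 2 * (ρ : ℂ) ^ 2 + 4 * A * ω * w ^ 3 * (ρ : ℂ) ^ 3
      + A * w ^ 4 * (ρ : ℂ) ^ 4).re ≤ -c * ρ ^ 2) :
    Tendsto (fun σ : ℝ => (σ : ℂ) *
        rayIntegral (expQuartic A B (C * σ ^ 3)) ((σ * x₀ : ℝ) : ℂ) w *
        Complex.exp (-((σ : ℂ) ^ 4 * (A * ω ^ 4 + C * ω) + (σ : ℂ) ^ 2 * (B * ω ^ 2)))) atTop
      (nhds (w * ∫ x : ℝ, Complex.exp (6 * A * ω ^ 2 * w ^ 2 * (x : ℂ) ^ 2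
        + 2 * B * ω * w * (x : ℂ)))) := by
  have h1 := ((tendsto_laplace (k₁ := 2 * B * ω * w) (k₂ := B * w ^ 2) ha hc H).comp
    (tendsto_pow_atTop (α := ℝ) (two_ne_zero))).const_mul w
  refine h1.congr' ?_
  filter_upwards [eventually_gt_atTop 0] with σ hσ
  -- The substitution r = σ(ρ + a) puts the saddle at ρ = 0. Its Jacobian σ, with the factor σ in
  -- the statement, supplies the factor b = σ² of Laplace's method.
  have e1 : rayIntegral (expQuartic A B (C * σ ^ 3)) ((σ * x₀ : ℝ) : ℂ) w
      = (σ : ℂ) * ∫ ρ in Set.Ioi (-a),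
        expQuartic A B (C * σ ^ 3) (((σ * x₀ : ℝ) : ℂ) + ((σ * (ρ + a) : ℝ) : ℂ) * w) * w := by
    have hshift := (measurePreserving_add_right volume a).setIntegral_preimage_emb
      (measurableEmbedding_addRight a) (fun r : ℝ =>
      expQuartic A B (C * σ ^ 3) (((σ * x₀ : ℝ) : ℂ) + ((σ * r : ℝ) : ℂ) * w) * w) (Set.Ioi 0)
    rw [Set.preimage_add_const_Ioi, zero_sub] at hshift
    rw [hshift, ← Complex.real_smul, integral_comp_mul_left_Ioi' (fun r : ℝ =>
      expQuartic A B (C * σ ^ 3) (((σ * x₀ : ℝ) : ℂ) + (r : ℂ) * w) * w) _ hσ]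
    simp [rayIntegral]
  have e2 : ∀ ρ : ℝ,
      expQuartic A B (C * σ ^ 3) (((σ * x₀ : ℝ) : ℂ) + ((σ * (ρ + a) : ℝ) : ℂ) * w) * w
      = (w * Complex.exp ((σ : ℂ) ^ 4 * (A * ω ^ 4 + C * ω) + (σ : ℂ) ^ 2 * (B * ω ^ 2))) *
        Complex.exp ((((σ ^ 2 : ℝ) : ℂ)) ^ 2 *
      (6 * A * ω ^ 2 * w ^ 2 * (ρ : ℂ) ^ 2 + 4 * A * ω * w ^ 3 * (ρ : ℂ) ^ 3
        + A * w ^ 4 * (ρ : ℂ) ^ 4)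
        + ((σ ^ 2 : ℝ) : ℂ) * (2 * B * ω * w * (ρ : ℂ) + B * w ^ 2 * (ρ : ℂ) ^ 2)) := by
    intro ρ
    rw [mul_assoc, ← Complex.exp_add, mul_comm, expQuartic]
    congr 2
    have : ((σ * x₀ : ℝ) : ℂ) + ((σ * (ρ + a) : ℝ) : ℂ) * w = σ * (ω + ρ * w) := by
      rw [← hω]; push_cast; ring
    rw [this]
    push_cast
    -- The saddle equation removes the term of order σ⁴ that is linear in ρ.
    linear_combination ((σ : ℂ) ^ 4 * (ρ * w)) * hs
  rw [e1]
  simp only [e2, Function.comp]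
  rw [integral_const_mul, Complex.exp_neg]
  have := Complex.exp_ne_zero ((σ : ℂ) ^ 4 * (A * ω ^ 4 + C * ω) + (σ : ℂ) ^ 2 * (B * ω ^ 2))
  generalize (∫ ρ in Set.Ioi (-a), _ : ℂ) = J
  push_cast
  field_simp

/-! ### Q and P as imaginary parts of ray integrals -/

theorem inv_two_I_pi_mul_sub_conj (Z : ℂ) :
    1 / (2 * Complex.I * (Real.pi : ℂ)) * (Z - starRingEnd ℂ Z) = ((Z.im / Real.pi : ℝ) : ℂ) := by
  have hpi : (Real.pi : ℂ) ≠ 0 := by exact_mod_cast Real.pi_ne_zero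
  rw [Complex.sub_conj]
  push_cast
  field_simp

theorem direction_eq (α : ℝ) : direction α = (Real.cos α : ℂ) + (Real.sin α : ℂ) * Complex.I := by
  rw [direction, Complex.exp_mul_I, Complex.ofReal_cos, Complex.ofReal_sin]

theorem direction_neg (α : ℝ) : direction (-α) = starRingEnd ℂ (direction α) := by
  simp [direction, ← Complex.exp_conj]

theorem direction_pi_div_four :
    direction (Real.pi / 4) = ((√2 / 2 : ℝ) : ℂ) * (1 + Complex.I) := by
  rw [direction_eq, Real.cos_pi_div_four, Real.sin_pi_div_four]; ring

theorem direction_three_pi_div_four :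
    direction (3 * Real.pi / 4) = ((√2 / 2 : ℝ) : ℂ) * (-1 + Complex.I) := by
  have : 3 * Real.pi / 4 = Real.pi - Real.pi / 4 := by ring
  rw [direction_eq, this, Real.cos_pi_sub, Real.sin_pi_sub, Real.cos_pi_div_four,
    Real.sin_pi_div_four]
  push_cast
  ring

theorem imagAxisIntegral_eq {A B C : ℝ} (hA : A < 0) :
    imagAxisIntegral (expQuartic A B C) = rayIntegral (expQuartic A B C) (0 : ℝ) Complex.I
      - starRingEnd ℂ (rayIntegral (expQuartic A B C) (0 : ℝ) Complex.I) := by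
  rw [← rayIntegral_conj, Complex.conj_ofReal, Complex.conj_I, imagAxisIntegral]
  have h1 := integrableOn_expQuartic_ray (A := A) (B := B) (C := C) (z := 0) (w := Complex.I)
    (by simpa using hA)
  have h2 := integrableOn_expQuartic_ray (A := A) (B := B) (C := C) (z := 0) (w := -Complex.I)
    (by rw [Even.neg_pow (by decide)]; simpa using hA)
  have h3 : IntegrableOn (fun t : ℝ => expQuartic A B C ((t : ℂ) * Complex.I) * Complex.I)
      (Set.Iic 0) := by
    rw [← integrableOn_Ici_iff_integrableOn_Ioi] at h2
    have := (Measure.measurePreserving_neg (volume : Measure ℝ)).integrableOn_comp_preimage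
      (Homeomorph.neg ℝ).isClosedEmbedding.measurableEmbedding
      (f := fun t : ℝ => expQuartic A B C (0 + (t : ℂ) * -Complex.I) * -Complex.I)
      (s := Set.Ici 0)
    have h4 := (this.2 h2).neg
    simp only [Set.neg_preimage, Set.neg_Ici, neg_zero] at h4
    refine h4.congr_fun (fun t _ => ?_) measurableSet_Iic
    simp
  rw [← intervalIntegral.integral_Iic_add_Ioi h3 (by simpa using h1)]
  have h5 := integral_comp_neg_Ioi 0
    (fun t : ℝ => expQuartic A B C ((t : ℂ) * Complex.I) * Complex.I)
  rw [neg_zero] at h5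
  rw [← h5, rayIntegral, rayIntegral, ← sub_eq_zero]
  simp only [Complex.ofReal_zero, zero_add, mul_neg, integral_neg, Complex.ofReal_neg, neg_mul]
  ring

theorem exp_neg_pearceyPhase (τ s : ℝ) :
    (fun μ => Complex.exp (-pearceyPhase τ s μ)) = expQuartic (-1 / 4) (τ / 2) s := by
  ext μ
  rw [expQuartic, pearceyPhase]
  congr 1
  push_cast
  ring

theorem exp_pearceyPhase (τ s : ℝ) :
    (fun μ => Complex.exp (pearceyPhase τ s μ)) = expQuartic (1 / 4) (-τ / 2) (-s) := by
  ext μ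
  rw [expQuartic, pearceyPhase]
  congr 1
  push_cast
  ring

/-- The real base point is left free so that it may depend on s; −s^{1/3}/2 will put the saddle on
the ray. -/
theorem pearceyQ_eq (τ s x : ℝ) : pearceyQ τ s =
    (((rayIntegral (expQuartic (-1 / 4) (τ / 2) s) x Complex.I).im / Real.pi : ℝ) : ℂ) := by
  rw [pearceyQ, exp_neg_pearceyPhase, imagAxisIntegral_eq (by norm_num),
    inv_two_I_pi_mul_sub_conj, im_rayIntegral_eq (x' := x) (w' := Complex.I)]
  intro t _
  simp
  norm_num

/-- The directions 3π/4 and 5π/6 lie in one sector of decay, 5π/8 < arg < 7π/8, so the left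
component may be turned towards the complex saddle. The right component keeps its direction and only
has it rescaled to 1 + i. -/
theorem pearceyP_eq (δ τ s x : ℝ) : pearceyP δ τ s =
    (((rayIntegral (expQuartic (1 / 4) (-τ / 2) (-s)) x (-(√3 / 2 : ℝ) + Complex.I / 2)).im
      / Real.pi
      - (rayIntegral (expQuartic (1 / 4) (-τ / 2) (-s)) x (1 + Complex.I)).im / Real.pi : ℝ)
      : ℂ) := by
  set f := expQuartic (1 / 4) (-τ / 2) (-s) with hf
  have e1 : pearceyP δ τ s = 1 / (2 * Complex.I * (Real.pi : ℂ)) *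
      (rayIntegral f ((-δ : ℝ) : ℂ) (direction (3 * Real.pi / 4))
        - starRingEnd ℂ (rayIntegral f ((-δ : ℝ) : ℂ) (direction (3 * Real.pi / 4))))
      - 1 / (2 * Complex.I * (Real.pi : ℂ)) *
      (rayIntegral f δ (direction (Real.pi / 4))
        - starRingEnd ℂ (rayIntegral f δ (direction (Real.pi / 4)))) := by
    rw [pearceyP, exp_pearceyPhase, ← rayIntegral_conj, ← rayIntegral_conj, sigmaIntegral,
      Complex.conj_ofReal, Complex.conj_ofReal, direction_neg, direction_neg, ← hf]
    push_cast
    ring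
  rw [e1, inv_two_I_pi_mul_sub_conj, inv_two_I_pi_mul_sub_conj, Complex.ofReal_sub,
    im_rayIntegral_eq (x := -δ) (x' := x) (w' := -(√3 / 2 : ℝ) + Complex.I / 2),
    im_rayIntegral_eq (x := δ) (x' := x) (w' := 1 + Complex.I)]
  · rintro t ⟨h0, h1⟩
    rw [direction_pi_div_four]
    set κ := √2 / 2 with hκ
    have hκ0 : 0 < κ := by positivity
    have e : ((1 / 4 : ℝ) : ℂ) * ((κ : ℂ) * (1 + Complex.I)
        + (t : ℂ) * ((1 + Complex.I) - (κ : ℂ) * (1 + Complex.I))) ^ 4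
        = ((-(κ + t * (1 - κ)) ^ 4 : ℝ) : ℂ) := by
      have h4 : (1 + Complex.I) ^ 4 = -4 := by
        have : (1 + Complex.I) ^ 2 = 2 * Complex.I := by
          linear_combination Complex.I_sq
        linear_combination ((1 + Complex.I) ^ 2 + 2 * Complex.I) * this + 4 * Complex.I_sq
      have : ((κ : ℂ) * (1 + Complex.I)
        + (t : ℂ) * ((1 + Complex.I) - (κ : ℂ) * (1 + Complex.I)))
        = (κ + t * (1 - κ)) * (1 + Complex.I) := by ring
      rw [this, mul_pow, h4]
      push_cast
      ring
    rw [e, Complex.ofReal_re]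
    have hκ1 : κ ≤ 1 := by
      rw [hκ, div_le_one (by norm_num), Real.sqrt_le_left (by norm_num)]; norm_num
    have : 0 < κ + t * (1 - κ) := by
      have := mul_nonneg h0 (sub_nonneg.2 hκ1)
      linarith
    have := pow_pos this 4
    linarith
  · rintro t ⟨h0, h1⟩
    rw [direction_three_pi_div_four]
    set κ := √2 / 2 with hκ
    have hκ0 : 0 < κ := by positivity
    have h3 : (√3) ^ 2 = 3 := Real.sq_sqrt (by norm_num)
    set q := √3 with hq
    have hq0 : 0 ≤ q := Real.sqrt_nonneg 3
    have hq1 : 1 ≤ q := by nlinarith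
    set a := (1 - t) * κ + t * (q / 2) with ha
    set b := (1 - t) * κ + t / 2 with hb
    -- Each intermediate direction is −a + bi, and the real part of its fourth power is (a² − b²)² −
    -- 4a²b². Negativity thus reduces to 0 ≤ a² − b² < 2ab.
    have e : ((1 / 4 : ℝ) : ℂ) * ((κ : ℂ) * (-1 + Complex.I)
        + (t : ℂ) * ((-((q / 2 : ℝ) : ℂ) + Complex.I / 2) - (κ : ℂ) * (-1 + Complex.I))) ^ 4
        = (((a ^ 2 - b ^ 2) ^ 2 - 4 * a ^ 2 * b ^ 2) / 4 : ℝ)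
          + ((-(a ^ 2 - b ^ 2) * a * b : ℝ) : ℂ) * Complex.I := by
      have h1 : ((κ : ℂ) * (-1 + Complex.I)
        + (t : ℂ) * ((-((q / 2 : ℝ) : ℂ) + Complex.I / 2) - (κ : ℂ) * (-1 + Complex.I)))
        = -a + b * Complex.I := by
        rw [ha, hb]; push_cast; ring
      have h2 : (-(a : ℂ) + b * Complex.I) ^ 2 = (a ^ 2 - b ^ 2) - 2 * a * b * Complex.I := by
        linear_combination (b : ℂ) ^ 2 * Complex.I_sq
      rw [h1, show ∀ z : ℂ, z ^ 4 = (z ^ 2) ^ 2 from fun z => by ring, h2]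
      push_cast
      linear_combination (a : ℂ) ^ 2 * b ^ 2 * Complex.I_sq
    have hd : a ^ 2 - b ^ 2 - 2 * (a * b)
        = -(2 * (((1 - t) * κ) * t) + 2 * ((1 - t) * κ) ^ 2 + t ^ 2 * ((q - 1) / 2)) := by
      rw [ha, hb]; linear_combination t ^ 2 / 4 * h3
    have hA0 : 0 ≤ (1 - t) * κ := mul_nonneg (by linarith) hκ0.le
    have hb0 : 0 < b := by
      rcases h0.eq_or_lt with rfl | h0
      · simpa [hb] using hκ0
      · linarith
    have hba : b ≤ a := by
      rw [ha, hb]; nlinarith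
    have hq2 : 1 < q := by nlinarith
    have hpos : 0 < 2 * (((1 - t) * κ) * t) + 2 * ((1 - t) * κ) ^ 2 + t ^ 2 * ((q - 1) / 2) := by
      rcases h0.eq_or_lt with rfl | h0
      · simpa using pow_pos hκ0 2
      · have : 0 < t ^ 2 * ((q - 1) / 2) := by
          have : 0 < q - 1 := by linarith
          positivity
        positivity
    have hlt : a ^ 2 - b ^ 2 < 2 * (a * b) := by linarith
    have hsq : (a ^ 2 - b ^ 2) ^ 2 < (2 * (a * b)) ^ 2 :=
      pow_lt_pow_left₀ hlt (by nlinarith) two_ne_zero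
    rw [e]
    simp only [Complex.add_re, Complex.ofReal_re, Complex.re_ofReal_mul, Complex.I_re, mul_zero,
      add_zero]
    linarith

/-! ### The negligible real saddle -/

/-- In direction 1 + i the second-order terms in r are purely imaginary, so the decay in r comes
from −r⁴ ≤ −r² + 1/4. Half of this r² absorbs the cross term: −τσr ≤ (τ²σ² + r²)/2. -/
theorem norm_expQuartic_ray_le {τ σ r : ℝ} (hσ : 0 ≤ σ) (hr : 0 ≤ r) :
    ‖expQuartic (1 / 4) (-τ / 2) (-σ ^ 3) (σ + (r : ℂ) * (1 + Complex.I)) * (1 + Complex.I)‖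
      ≤ ‖1 + Complex.I‖ * Real.exp (-(3 / 4) * σ ^ 4 + (|τ| + τ ^ 2) / 2 * σ ^ 2 + 1 / 4)
        * Real.exp (-(1 / 2) * r ^ 2) := by
  have e : ((1 / 4 : ℝ) : ℂ) * (σ + (r : ℂ) * (1 + Complex.I)) ^ 4
      + ((-τ / 2 : ℝ) : ℂ) * (σ + (r : ℂ) * (1 + Complex.I)) ^ 2
      + ((-σ ^ 3 : ℝ) : ℂ) * (σ + (r : ℂ) * (1 + Complex.I))
      = ((-(3 / 4) * σ ^ 4 - 2 * σ * r ^ 3 - r ^ 4 - τ / 2 * σ ^ 2 - τ * σ * r : ℝ) : ℂ)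
        + ((((σ + r) ^ 2 - r ^ 2) * (σ + r) * r - τ * (σ + r) * r - σ ^ 3 * r : ℝ) : ℂ)
          * Complex.I := by
    push_cast
    linear_combination ((1 / 4 : ℂ) * (6 * (σ + r) ^ 2 * r ^ 2 + 4 * (σ + r) * r ^ 3 * Complex.I
      + r ^ 4 * (Complex.I ^ 2 - 1)) - (τ : ℂ) / 2 * r ^ 2) * Complex.I_sq
  rw [norm_mul, expQuartic, Complex.norm_exp, e, mul_comm,
    mul_assoc ‖1 + Complex.I‖, ← Real.exp_add]
  gcongr
  simp only [Complex.add_re, Complex.ofReal_re, Complex.re_ofReal_mul, Complex.I_re, mul_zero,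
      add_zero]
  have h1 : -τ * σ ^ 2 ≤ |τ| * σ ^ 2 := by gcongr; exact neg_le_abs τ
  have h2 : 0 ≤ 2 * σ * r ^ 3 := by positivity
  nlinarith [sq_nonneg (τ * σ + r), sq_nonneg (r ^ 2 - 1 / 2)]

/-- The integral along a ray from the real saddle point is negligible. -/
theorem tendsto_rayIntegral_real_saddle (τ : ℝ) :
    Tendsto (fun σ : ℝ => σ * Real.exp (-(3 / 8 * σ ^ 4 + τ / 4 * σ ^ 2 - τ ^ 2 / 6)) *
      ‖rayIntegral (expQuartic (1 / 4) (-τ / 2) (-σ ^ 3)) σ (1 + Complex.I)‖) atTop (nhds 0) := by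
  set J := ∫ r in Set.Ioi (0 : ℝ), Real.exp (-(1 / 2) * r ^ 2) with hJ
  have hJ0 : 0 ≤ J := integral_nonneg fun _ => (Real.exp_pos _).le
  set K := (|τ| + τ ^ 2) / 2 + |τ| / 4 with hK
  set D := ‖1 + Complex.I‖ * J * Real.exp (1 / 4 + τ ^ 2 / 6) with hD
  have hlim : Tendsto (fun σ : ℝ => D * (σ ^ 1 * Real.exp (-σ))) atTop (nhds 0) := by
    simpa using (Real.tendsto_pow_mul_exp_neg_atTop_nhds_zero 1).const_mul D
  refine squeeze_zero' ?_ ?_ hlim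
  · filter_upwards [eventually_ge_atTop 0] with σ hσ
    positivity
  -- For such σ, σ⁴ ≥ (1 + K)σ², which absorbs every term in σ² and still leaves −σ² ≤ −σ.
  · filter_upwards [eventually_ge_atTop (1 + K)] with σ hσ
    have hK0 : 0 ≤ K := by positivity
    have hσ1 : 1 ≤ σ := by linarith
    have hR : ‖rayIntegral (expQuartic (1 / 4) (-τ / 2) (-σ ^ 3)) σ (1 + Complex.I)‖
        ≤ ‖1 + Complex.I‖ * Real.exp (-(3 / 4) * σ ^ 4 + (|τ| + τ ^ 2) / 2 * σ ^ 2 + 1 / 4) * J := by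
      rw [hJ, ← integral_const_mul]
      refine norm_integral_le_of_norm_le
        (((integrable_exp_neg_mul_sq (by norm_num)).const_mul _).integrableOn) ?_
      filter_upwards [ae_restrict_mem measurableSet_Ioi] with r hr
      exact norm_expQuartic_ray_le (by linarith) (le_of_lt hr)
    have hexp : -(3 / 8 * σ ^ 4 + τ / 4 * σ ^ 2 - τ ^ 2 / 6)
        + (-(3 / 4) * σ ^ 4 + (|τ| + τ ^ 2) / 2 * σ ^ 2 + 1 / 4) ≤ -σ + (1 / 4 + τ ^ 2 / 6) := by
      have h1 : -τ * σ ^ 2 ≤ |τ| * σ ^ 2 := by gcongr; exact neg_le_abs τ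
      have h2 : σ ≤ σ ^ 2 := le_self_pow₀ hσ1 (by norm_num)
      have h3 : σ ^ 2 * (1 + K) ≤ σ ^ 2 * σ ^ 2 := by gcongr; linarith
      have h4 : 0 ≤ σ ^ 4 := by positivity
      rw [hK] at h3
      linarith
    calc _ ≤ σ * Real.exp (-(3 / 8 * σ ^ 4 + τ / 4 * σ ^ 2 - τ ^ 2 / 6)) *
          (‖1 + Complex.I‖ *
            Real.exp (-(3 / 4) * σ ^ 4 + (|τ| + τ ^ 2) / 2 * σ ^ 2 + 1 / 4) * J) := by gcongr
      _ = ‖1 + Complex.I‖ * J * σ * Real.exp (-(3 / 8 * σ ^ 4 + τ / 4 * σ ^ 2 - τ ^ 2 / 6)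
          + (-(3 / 4) * σ ^ 4 + (|τ| + τ ^ 2) / 2 * σ ^ 2 + 1 / 4)) := by
        rw [Real.exp_add (-(3 / 8 * σ ^ 4 + τ / 4 * σ ^ 2 - τ ^ 2 / 6))]; ring
      _ ≤ ‖1 + Complex.I‖ * J * σ * Real.exp (-σ + (1 / 4 + τ ^ 2 / 6)) := by gcongr
      _ = _ := by rw [Real.exp_add, hD]; ring

/-! ### Contributions of the complex saddle -/

theorem sqrt_three_sq : ((√3 : ℝ) : ℂ) ^ 2 = 3 := by
  rw [← Complex.ofReal_pow, Real.sq_sqrt (by norm_num)]; norm_num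

/-- The saddle point contribution to `Q`. -/
theorem tendsto_rayIntegral_Q (τ : ℝ) :
    Tendsto (fun σ : ℝ => (σ : ℂ) *
        rayIntegral (expQuartic (-1 / 4) (τ / 2) (1 * σ ^ 3)) ((σ * (-1 / 2) : ℝ) : ℂ) Complex.I *
        Complex.exp (-(((-(3 / 8 * σ ^ 4 + τ / 4 * σ ^ 2) : ℝ) : ℂ)
          + ((3 / 4 * (√3 / 2) * σ ^ 4 - τ / 2 * (√3 / 2) * σ ^ 2 : ℝ) : ℂ) * Complex.I))) atTop
      (nhds (((√(2 * Real.pi / 3) * Real.exp (τ ^ 2 / 6) : ℝ) : ℂ)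
        * (1 / 2 + √3 / 2 * Complex.I))) := by
  have h3 := sqrt_three_sq
  have hq : √3 ^ 2 = 3 := Real.sq_sqrt (by norm_num)
  have hq0 : 0 < √3 := by positivity
  set q := √3 with hqd
  set ω : ℂ := -1 / 2 + q / 2 * Complex.I with hω
  have hω2 : ω ^ 2 = -1 / 2 - q / 2 * Complex.I := by
    rw [hω]; linear_combination (q : ℂ) ^ 2 / 4 * Complex.I_sq - 1 / 4 * h3
  have hω3 : ω ^ 3 = 1 := by
    rw [pow_succ, hω2, hω]; linear_combination -(q : ℂ) ^ 2 / 4 * Complex.I_sq + 1 / 4 * h3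
  have hre : ∀ ρ : ℝ, (6 * ((-1 / 4 : ℝ) : ℂ) * ω ^ 2 * Complex.I ^ 2 * (ρ : ℂ) ^ 2
      + 4 * ((-1 / 4 : ℝ) : ℂ) * ω * Complex.I ^ 3 * (ρ : ℂ) ^ 3
      + ((-1 / 4 : ℝ) : ℂ) * Complex.I ^ 4 * (ρ : ℂ) ^ 4)
      = ((-(3 / 4) * ρ ^ 2 - q / 2 * ρ ^ 3 - ρ ^ 4 / 4 : ℝ) : ℂ)
        + ((-(3 / 4) * q * ρ ^ 2 - 1 / 2 * ρ ^ 3 : ℝ) : ℂ) * Complex.I := by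
    intro ρ
    rw [hω2, hω, Complex.I_pow_three, Complex.I_pow_four, Complex.I_sq]
    push_cast
    linear_combination (q : ℂ) / 2 * ρ ^ 3 * Complex.I_sq
  have key := tendsto_rayIntegral_saddle (A := -1 / 4) (B := τ / 2) (C := 1) (x₀ := -1 / 2)
    (a := q / 2) (c := 3 / 16) (w := Complex.I) (ω := ω) (by positivity) (by norm_num)
    (by rw [hω]; push_cast; ring) (by rw [hω3]; push_cast; ring) (by
      intro ρ hρ
      rw [hre]
      simp only [Complex.add_re, Complex.ofReal_re, Complex.re_ofReal_mul, Complex.I_re, mul_zero,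
        add_zero]
      -- The real part is exactly −ρ²(ρ + q)²/4 as q² = 3, and ρ > −q/2; this yields the constant
      -- 3/16.
      have : 3 / 4 ≤ (ρ + q) ^ 2 := by nlinarith
      have := mul_le_mul_of_nonneg_left this (sq_nonneg ρ)
      nlinarith)
  have hint := integral_cexp_quadratic
    (b := 6 * ((-1 / 4 : ℝ) : ℂ) * ω ^ 2 * Complex.I ^ 2)
    (by
      rw [hω2, Complex.I_sq]
      simp
      norm_num) (2 * ((τ / 2 : ℝ) : ℂ) * ω * Complex.I) 0
  simp only [add_zero] at hint
  have hω0 : ω ≠ 0 := by intro h; simp [h] at hω3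
  have hx : (Real.pi : ℂ) / -(6 * ((-1 / 4 : ℝ) : ℂ) * ω ^ 2 * Complex.I ^ 2)
      = (((√(2 * Real.pi / 3) : ℝ) : ℂ) * (q / 2 - 1 / 2 * Complex.I)) ^ 2 := by
    have hs : ((√(2 * Real.pi / 3) : ℝ) : ℂ) ^ 2 = 2 * Real.pi / 3 := by
      rw [← Complex.ofReal_pow, Real.sq_sqrt (by positivity)]; push_cast; ring
    have hsq : ((q : ℂ) / 2 - 1 / 2 * Complex.I) ^ 2 = -ω := by
      rw [hω]; linear_combination 1 / 4 * h3 + 1 / 4 * Complex.I_sq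
    rw [mul_pow, hs, hsq, Complex.I_sq, div_eq_iff (by push_cast; simp [hω0])]
    push_cast
    linear_combination -(Real.pi : ℂ) * hω3
  -- The principal root is the one with positive real part, which fixes the sign.
  have hcpow : ((Real.pi : ℂ) / -(6 * ((-1 / 4 : ℝ) : ℂ) * ω ^ 2 * Complex.I ^ 2)) ^ (1 / 2 : ℂ)
      = ((√(2 * Real.pi / 3) : ℝ) : ℂ) * (q / 2 - 1 / 2 * Complex.I) := by
    rw [hx, one_div, Complex.sq_cpow_two_inv]
    rw [Complex.re_ofReal_mul]
    simp
    positivity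
  have hexp : 0 - (2 * ((τ / 2 : ℝ) : ℂ) * ω * Complex.I) ^ 2 /
      (4 * (6 * ((-1 / 4 : ℝ) : ℂ) * ω ^ 2 * Complex.I ^ 2)) = ((τ ^ 2 / 6 : ℝ) : ℂ) := by
    push_cast
    have := Complex.I_ne_zero
    field_simp
    ring
  rw [hint, hcpow, hexp] at key
  convert key using 2 with σ
  · congr 2
    rw [show ω ^ 4 = ω by rw [pow_succ, hω3, one_mul], hω2, hω]
    push_cast
    ring
  · push_cast
    linear_combination (1 / 2 * (√(2 * Real.pi / 3) : ℂ) * Complex.exp (τ ^ 2 / 6)) * Complex.I_sq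

/-- The saddle point contribution to `P`. -/
theorem tendsto_rayIntegral_P (τ : ℝ) :
    Tendsto (fun σ : ℝ => (σ : ℂ) *
        rayIntegral (expQuartic (1 / 4) (-τ / 2) (-1 * σ ^ 3)) ((σ * 1 : ℝ) : ℂ)
          (-(√3 / 2 : ℝ) + Complex.I / 2) *
        Complex.exp (-(((3 / 8 * σ ^ 4 + τ / 4 * σ ^ 2 : ℝ) : ℂ)
          - ((3 / 4 * (√3 / 2) * σ ^ 4 - τ / 2 * (√3 / 2) * σ ^ 2 : ℝ) : ℂ) * Complex.I))) atTop
      (nhds (((√(2 * Real.pi / 3) * Real.exp (-(τ ^ 2 / 6)) : ℝ) : ℂ)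
        * (-(√3 / 2 : ℝ) + Complex.I / 2))) := by
  have h3 := sqrt_three_sq
  have hq : √3 ^ 2 = 3 := Real.sq_sqrt (by norm_num)
  have hq0 : 0 < √3 := by positivity
  set q := √3 with hqd
  set ω : ℂ := -1 / 2 + q / 2 * Complex.I with hω
  set w : ℂ := -((q / 2 : ℝ) : ℂ) + Complex.I / 2 with hw
  have hω2 : ω ^ 2 = -1 / 2 - q / 2 * Complex.I := by
    rw [hω]; linear_combination (q : ℂ) ^ 2 / 4 * Complex.I_sq - 1 / 4 * h3
  have hω3 : ω ^ 3 = 1 := by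
    rw [pow_succ, hω2, hω]; linear_combination -(q : ℂ) ^ 2 / 4 * Complex.I_sq + 1 / 4 * h3
  -- Hence ω²w² = −1: the ray has the direction of steepest descent at ω, and the Gaussian has a
  -- real quadratic coefficient.
  have hwω : w = -(ω ^ 2 * Complex.I) := by
    rw [hw, hω2]; push_cast; linear_combination -(q : ℂ) / 2 * Complex.I_sq
  have hg₂ : 6 * ((1 / 4 : ℝ) : ℂ) * ω ^ 2 * w ^ 2 = ((-(3 / 2) : ℝ) : ℂ) := by
    rw [hwω]; push_cast
    linear_combination 3 / 2 * (ω ^ 6) * Complex.I_sq - 3 / 2 * (ω ^ 3 + 1) * hω3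
  have hg₃ : 4 * ((1 / 4 : ℝ) : ℂ) * ω * w ^ 3 = ((-q / 2 : ℝ) : ℂ) + ((-1 / 2 : ℝ) : ℂ) * Complex.I := by
    have : 4 * ((1 / 4 : ℝ) : ℂ) * ω * w ^ 3 = ω * Complex.I := by
      rw [hwω]; push_cast
      linear_combination -(ω ^ 7) * Complex.I * Complex.I_sq
        + ω * Complex.I * (ω ^ 3 + 1) * hω3
    rw [this, hω]; push_cast; linear_combination (q : ℂ) / 2 * Complex.I_sq
  have hg₄ : ((1 / 4 : ℝ) : ℂ) * w ^ 4 = ((-1 / 8 : ℝ) : ℂ) + ((-q / 8 : ℝ) : ℂ) * Complex.I := by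
    have : ((1 / 4 : ℝ) : ℂ) * w ^ 4 = 1 / 4 * ω ^ 2 := by
      rw [hwω]; push_cast
      linear_combination 1 / 4 * (ω ^ 8) * (Complex.I ^ 2 - 1) * Complex.I_sq
        + 1 / 4 * ω ^ 2 * (ω ^ 3 + 1) * hω3
    rw [this, hω2]; push_cast; ring
  have hk₁ : 2 * ((-τ / 2 : ℝ) : ℂ) * ω * w = (τ : ℂ) * Complex.I := by
    rw [hwω]; push_cast; linear_combination (τ : ℂ) * Complex.I * hω3
  have key := tendsto_rayIntegral_saddle (A := 1 / 4) (B := -τ / 2) (C := -1) (x₀ := 1)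
    (a := q) (c := 3 / 8) (w := w) (ω := ω) hq0 (by norm_num)
    (by rw [hω, hw]; push_cast; linear_combination -1 / 2 * h3) (by rw [hω3]; push_cast; ring) (by
      intro ρ hρ
      rw [hg₂, hg₃, hg₄]
      have e : ((-(3 / 2) : ℝ) : ℂ) * (ρ : ℂ) ^ 2
          + (((-q / 2 : ℝ) : ℂ) + ((-1 / 2 : ℝ) : ℂ) * Complex.I) * (ρ : ℂ) ^ 3
          + (((-1 / 8 : ℝ) : ℂ) + ((-q / 8 : ℝ) : ℂ) * Complex.I) * (ρ : ℂ) ^ 4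
          = ((-(3 / 2) * ρ ^ 2 - q / 2 * ρ ^ 3 - ρ ^ 4 / 8 : ℝ) : ℂ)
            + ((-1 / 2 * ρ ^ 3 - q / 8 * ρ ^ 4 : ℝ) : ℂ) * Complex.I := by
        push_cast; ring
      rw [e]
      simp only [Complex.add_re, Complex.ofReal_re, Complex.re_ofReal_mul, Complex.I_re, mul_zero,
        add_zero]
      -- The real part is −ρ²(ρ + 2q)²/8, and ρ > −q; this yields the constant 3/8.
      have : 3 ≤ (ρ + 2 * q) ^ 2 := by nlinarith
      have := mul_le_mul_of_nonneg_left this (sq_nonneg ρ)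
      nlinarith)
  rw [hg₂, hk₁] at key
  have hint := integral_cexp_quadratic (b := ((-(3 / 2) : ℝ) : ℂ))
    (by rw [Complex.ofReal_re]; norm_num) ((τ : ℂ) * Complex.I) 0
  simp only [add_zero] at hint
  have hcpow : ((Real.pi : ℂ) / -((-(3 / 2) : ℝ) : ℂ)) ^ (1 / 2 : ℂ)
      = ((√(2 * Real.pi / 3) : ℝ) : ℂ) := by
    have : (Real.pi : ℂ) / -((-(3 / 2) : ℝ) : ℂ) = ((√(2 * Real.pi / 3) : ℝ) : ℂ) ^ 2 := by
      rw [← Complex.ofReal_pow, Real.sq_sqrt (by positivity)]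
      push_cast
      field_simp
    rw [this, one_div, Complex.sq_cpow_two_inv]
    rw [Complex.ofReal_re]
    positivity
  have hexp : 0 - ((τ : ℂ) * Complex.I) ^ 2 / (4 * ((-(3 / 2) : ℝ) : ℂ))
      = ((-(τ ^ 2 / 6) : ℝ) : ℂ) := by
    rw [mul_pow, Complex.I_sq]
    push_cast
    ring
  rw [hint, hcpow, hexp] at key
  convert key using 2 with σ
  · congr 2
    rw [show ω ^ 4 = ω by rw [pow_succ, hω3, one_mul], hω2, hω]
    push_cast
    ring
  · push_cast
    ring

/-! ### From limits at the saddle to the asymptotic formulas -/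

theorem isLittleO_sub_of_eventually_eq {F : ℝ → ℂ} {g v c : ℝ → ℝ}
    (h : ∀ᶠ s in atTop, F s = ((g s * v s : ℝ) : ℂ))
    (hv : Tendsto (fun s => v s - c s) atTop (nhds 0)) :
    (fun s => F s - ((g s * c s : ℝ) : ℂ)) =o[atTop] g := by
  have h1 : (fun s => g s * (v s - c s)) =o[atTop] g := by
    simpa using (isBigO_refl g atTop).mul_isLittleO ((isLittleO_one_iff ℝ).2 hv)
  refine (Complex.isLittleO_ofReal_left.2 h1).congr' ?_ EventuallyEq.rfl
  filter_upwards [h] with s hs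
  rw [hs]
  push_cast
  ring

/-- Extracts the oscillation from the limit of a normalised complex amplitude. -/
theorem tendsto_im_div_amplitude {R : ℝ → ℂ} {e ψ : ℝ → ℝ} {κ : ℝ} {d : ℂ}
    (h : Tendsto (fun σ : ℝ => (σ : ℂ) * R σ *
      Complex.exp (-((e σ : ℂ) + (ψ σ : ℂ) * Complex.I))) atTop
      (nhds (((√(2 * Real.pi / 3) * Real.exp κ : ℝ) : ℂ) * d))) :
    Tendsto (fun σ : ℝ => (R σ).im / Real.pi /
        (√(2 / (3 * Real.pi)) * σ⁻¹ * Real.exp (e σ + κ))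
      - (d * Complex.exp ((ψ σ : ℂ) * Complex.I)).im) atTop (nhds 0) := by
  -- Reconciles the Gaussian constant √(2π/3), divided by π, with the amplitude √(2/(3π)).
  have hc : √(2 * Real.pi / 3) = √(2 / (3 * Real.pi)) * Real.pi := by
    rw [← Real.sqrt_sq Real.pi_pos.le, ← Real.sqrt_mul (by positivity), Real.sqrt_sq Real.pi_pos.le]
    congr 1
    field_simp
  set M : ℝ := √(2 * Real.pi / 3) * Real.exp κ with hM
  have hM0 : (M : ℂ) ≠ 0 := by
    have : 0 < M := by positivity
    exact_mod_cast this.ne'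
  have h1 : Tendsto (fun σ : ℝ => ‖(M : ℂ)⁻¹ * ((σ : ℂ) * R σ *
      Complex.exp (-((e σ : ℂ) + (ψ σ : ℂ) * Complex.I))) - d‖) atTop (nhds 0) := by
    rw [← tendsto_iff_norm_sub_tendsto_zero]
    simpa [hM0] using h.const_mul (M : ℂ)⁻¹
  refine squeeze_zero_norm' ?_ h1
  filter_upwards [eventually_gt_atTop 0] with σ hσ
  set V := (M : ℂ)⁻¹ * ((σ : ℂ) * R σ *
      Complex.exp (-((e σ : ℂ) + (ψ σ : ℂ) * Complex.I))) with hV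
  have hR : R σ = ((M * σ⁻¹ * Real.exp (e σ) : ℝ) : ℂ) *
      (V * Complex.exp ((ψ σ : ℂ) * Complex.I)) := by
    have hσ' : (σ : ℂ) ≠ 0 := by exact_mod_cast hσ.ne'
    rw [hV, neg_add, Complex.exp_add, Complex.exp_neg, Complex.exp_neg]
    have := Complex.exp_ne_zero (e σ)
    have := Complex.exp_ne_zero ((ψ σ : ℂ) * Complex.I)
    push_cast
    field_simp
  have h2 : (R σ).im / Real.pi / (√(2 / (3 * Real.pi)) * σ⁻¹ * Real.exp (e σ + κ))
      - (d * Complex.exp ((ψ σ : ℂ) * Complex.I)).im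
      = ((V - d) * Complex.exp ((ψ σ : ℂ) * Complex.I)).im := by
    have h3 : (R σ).im / Real.pi / (√(2 / (3 * Real.pi)) * σ⁻¹ * Real.exp (e σ + κ))
        = (V * Complex.exp ((ψ σ : ℂ) * Complex.I)).im := by
      rw [hR, Complex.im_ofReal_mul, hM, hc, Real.exp_add]
      have : 0 < √(2 / (3 * Real.pi)) := by positivity
      field_simp
    rw [h3, sub_mul, Complex.sub_im]
  rw [h2, Real.norm_eq_abs]
  refine (Complex.abs_im_le_norm _).trans ?_
  rw [norm_mul, Complex.norm_exp_ofReal_mul_I, mul_one]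

theorem rpow_third_pow {s : ℝ} (hs : 0 < s) :
    (s ^ (1 / 3 : ℝ)) ^ 3 = s ∧ s ^ (4 / 3 : ℝ) = (s ^ (1 / 3 : ℝ)) ^ 4 ∧
      s ^ (2 / 3 : ℝ) = (s ^ (1 / 3 : ℝ)) ^ 2 ∧ s ^ (-(1 / 3) : ℝ) = (s ^ (1 / 3 : ℝ))⁻¹ := by
  refine ⟨?_, ?_, ?_, Real.rpow_neg hs.le _⟩ <;> rw [← Real.rpow_natCast, ← Real.rpow_mul hs.le] <;>
    norm_num

theorem sin_two_pi_div_three : Real.sin (2 * Real.pi / 3) = √3 / 2 := by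
  rw [show 2 * Real.pi / 3 = Real.pi - Real.pi / 3 by ring, Real.sin_pi_sub, Real.sin_pi_div_three]

/-- The prefactor is e^{iπ/3}, and sin(ψ + π/3) = cos(ψ − π/6). -/
theorem im_mul_exp_Q (ψ : ℝ) :
    ((1 / 2 + √3 / 2 * Complex.I) * Complex.exp ((ψ : ℂ) * Complex.I)).im
      = Real.cos (ψ - Real.pi / 6) := by
  rw [Complex.exp_mul_I, ← Complex.ofReal_cos, ← Complex.ofReal_sin, Real.cos_sub,
    Real.cos_pi_div_six, Real.sin_pi_div_six]
  simp [-Complex.ofReal_cos, -Complex.ofReal_sin]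
  ring

/-- The prefactor is e^{5πi/6}, and sin(5π/6 − ψ) = cos(ψ − π/3). -/
theorem im_mul_exp_P (ψ : ℝ) :
    ((-(√3 / 2 : ℝ) + Complex.I / 2) * Complex.exp (((-ψ : ℝ) : ℂ) * Complex.I)).im
      = Real.cos (ψ - Real.pi / 3) := by
  rw [Complex.exp_mul_I, ← Complex.ofReal_cos, ← Complex.ofReal_sin, Real.cos_sub,
    Real.cos_pi_div_three, Real.sin_pi_div_three, Real.cos_neg, Real.sin_neg]
  simp [-Complex.ofReal_cos, -Complex.ofReal_sin]
  ring

theorem pearceyQ_isLittleO (τ : ℝ) :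
    (fun s : ℝ => pearceyQ τ s -
        ((pearceyAmplitude s * Real.exp (-pearceyExponent τ s) *
          Real.cos (pearceyOscillation τ s - Real.pi / 6) : ℝ) : ℂ))
      =o[atTop] (fun s : ℝ => pearceyAmplitude s * Real.exp (-pearceyExponent τ s)) := by
  have h1 := (tendsto_im_div_amplitude (tendsto_rayIntegral_Q τ)).comp
    (tendsto_rpow_atTop (show (0 : ℝ) < 1 / 3 by norm_num))
  refine isLittleO_sub_of_eventually_eq (v := fun s => (rayIntegral (expQuartic (-1 / 4) (τ / 2) s)
    ((s ^ (1 / 3 : ℝ) * (-1 / 2) : ℝ) : ℂ) Complex.I).im / Real.pi /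
    (pearceyAmplitude s * Real.exp (-pearceyExponent τ s))) ?_ (h1.congr' ?_)
  · filter_upwards [eventually_gt_atTop 0] with s hs
    have : pearceyAmplitude s * Real.exp (-pearceyExponent τ s) ≠ 0 := by
      rw [pearceyAmplitude]; positivity
    rw [mul_div_cancel₀ _ this]
    exact pearceyQ_eq _ _ _
  · filter_upwards [eventually_gt_atTop 0] with s hs
    obtain ⟨e3, e4, e2, e1⟩ := rpow_third_pow hs
    simp only [Function.comp, im_mul_exp_Q, pearceyAmplitude, pearceyExponent, pearceyOscillation,
      sin_two_pi_div_three]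
    rw [one_mul, e3, e4, e2, e1]
    ring_nf

theorem pearceyP_isLittleO (δ τ : ℝ) :
    (fun s : ℝ => pearceyP δ τ s -
        ((pearceyAmplitude s * Real.exp (pearceyExponent τ s) *
          Real.cos (pearceyOscillation τ s - Real.pi / 3) : ℝ) : ℂ))
      =o[atTop] (fun s : ℝ => pearceyAmplitude s * Real.exp (pearceyExponent τ s)) := by
  -- The exponent of P is the negative of that of Q, so the oscillation at the same saddle enters
  -- with the opposite sign.
  have hmain := (tendsto_im_div_amplitude
    (R := fun σ : ℝ => rayIntegral (expQuartic (1 / 4) (-τ / 2) (-1 * σ ^ 3)) ((σ * 1 : ℝ) : ℂ)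
      (-(√3 / 2 : ℝ) + Complex.I / 2))
    (e := fun σ => 3 / 8 * σ ^ 4 + τ / 4 * σ ^ 2)
    (ψ := fun σ => -(3 / 4 * (√3 / 2) * σ ^ 4 - τ / 2 * (√3 / 2) * σ ^ 2))
    (by simpa only [Complex.ofReal_neg, neg_mul, ← sub_eq_add_neg] using tendsto_rayIntegral_P τ))
  have hneg : Tendsto (fun σ : ℝ =>
      (rayIntegral (expQuartic (1 / 4) (-τ / 2) (-σ ^ 3)) σ (1 + Complex.I)).im / Real.pi /
        (√(2 / (3 * Real.pi)) * σ⁻¹ * Real.exp (3 / 8 * σ ^ 4 + τ / 4 * σ ^ 2 - τ ^ 2 / 6)))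
      atTop (nhds 0) := by
    have h0 := (tendsto_rayIntegral_real_saddle τ).const_mul (√(2 / (3 * Real.pi)) * Real.pi)⁻¹
    rw [mul_zero] at h0
    refine squeeze_zero_norm' ?_ h0
    filter_upwards [eventually_gt_atTop 0] with σ hσ
    have hc : 0 < √(2 / (3 * Real.pi)) := by positivity
    have hpi := Real.pi_pos
    rw [Real.norm_eq_abs, div_div, abs_div, Real.exp_neg,
      abs_of_pos (a := Real.pi * _) (by positivity)]
    refine (div_le_div_of_nonneg_right (Complex.abs_im_le_norm _) (by positivity)).trans_eq ?_
    field_simp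
  have h1 := (hmain.sub hneg).comp (tendsto_rpow_atTop (show (0 : ℝ) < 1 / 3 by norm_num))
  rw [sub_zero] at h1
  refine isLittleO_sub_of_eventually_eq (v := fun s =>
    ((rayIntegral (expQuartic (1 / 4) (-τ / 2) (-s)) ((s ^ (1 / 3 : ℝ) : ℝ) : ℂ)
        (-(√3 / 2 : ℝ) + Complex.I / 2)).im / Real.pi
      - (rayIntegral (expQuartic (1 / 4) (-τ / 2) (-s)) ((s ^ (1 / 3 : ℝ) : ℝ) : ℂ)
        (1 + Complex.I)).im / Real.pi) /
    (pearceyAmplitude s * Real.exp (pearceyExponent τ s))) ?_ (h1.congr' ?_)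
  · filter_upwards [eventually_gt_atTop 0] with s hs
    have : pearceyAmplitude s * Real.exp (pearceyExponent τ s) ≠ 0 := by
      rw [pearceyAmplitude]; positivity
    rw [mul_div_cancel₀ _ this]
    exact pearceyP_eq _ _ _ _
  · filter_upwards [eventually_gt_atTop 0] with s hs
    obtain ⟨e3, e4, e2, e1⟩ := rpow_third_pow hs
    simp only [Function.comp, im_mul_exp_P, pearceyAmplitude, pearceyExponent, pearceyOscillation,
      sin_two_pi_div_three]
    rw [neg_one_mul, mul_one, e3, e4, e2, e1, sub_div]
    ring_nf

theorem mainTheorem6 (τ : ℝ) :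
    ((fun s : ℝ => pearceyQ τ s -
        ((pearceyAmplitude s * Real.exp (-pearceyExponent τ s) *
          Real.cos (pearceyOscillation τ s - Real.pi / 6) : ℝ) : ℂ))
      =o[atTop] (fun s : ℝ => pearceyAmplitude s * Real.exp (-pearceyExponent τ s))) ∧
    (∀ δ : ℝ, 0 < δ →
      (fun s : ℝ => pearceyP δ τ s -
        ((pearceyAmplitude s * Real.exp (pearceyExponent τ s) *
          Real.cos (pearceyOscillation τ s - Real.pi / 3) : ℝ) : ℂ))
      =o[atTop] (fun s : ℝ => pearceyAmplitude s * Real.exp (pearceyExponent τ s))) :=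
  ⟨pearceyQ_isLittleO τ, fun δ _ => pearceyP_isLittleO δ τ⟩
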